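/- Let $N\ge 1$ be an integer, $\alpha,\beta>-1$ and $\mu\in(0,1)$. For real $a,b$ let $P_n^{(a,b)}$ be the Jacobi polynomials in Szegő's normalization, $$P_n^{(a,b)}(x)=\frac1{n!}\sum_{k=0}^n\binom nk (n+a+b+1)_k\,(a+k+1)_{n-k}\Big(\frac{x-1}2\Big)^k,$$ where $(c)_k=c(c+1)\cdots(c+k-1)$; for $a,b>-1$ put $\omega^{(a,b)}(x)=(1-x)^a(1+x)^b$ and $$\gamma_n^{(a,b)}=\frac{2^{a+b+1}\,\Gamma(n+a+1)\,\Gamma(n+b+1)}{(2n+a+b+1)\,n!\,\Gamma(n+a+b+1)},$$ where for $n=0$ the product $(a+b+1)\Gamma(a+b+1)$ is read as $\Gamma(a+b+2)$. Let $-1=x_0<x_1<\dots<x_N=1$ be the Jacobi-Gauss-Lobatto (JGL) points, i.e. the zeros of $(1-x^2)\frac{d}{dx}P_N^{(\alpha,\beta)}(x)$ in ascending order, let $h_0,\dots,h_N$ be the Lagrange basis polynomials at these points, and let $\omega_j=\int_{-1}^1 h_j(x)\,\omega^{(\alpha,\beta)}(x)\,dx$ be the JGL quadrature weights. The modified fractional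 integral is $$(\hat I_-^{\mu}u)(x)=(1+x)^{-\mu}\,\frac1{\Gamma(\mu)}\int_{-1}^x\frac{u(y)}{(x-y)^{1-\mu}}\,dy,\qquad -1<x\le 1,$$ and $(\hat I_-^\mu u)(-1)$ is the limit of this as $x\to-1^+$. The modified fractional integral matrix $\hat{\boldsymbol I}^{(\mu)}\in\mathbb R^{(N+1)\times(N+1)}$ has the entries $\hat{\boldsymbol I}^{(\mu)}_{ij}=(\hat I_-^\mu h_j)(x_i)$, $0\le i,j\le N$. Then $\hat I_-^\mu h_j$ is well defined on $[-1,1]$ (for $-1<x\le1$ the integral converges absolutely, and the limit at $-1$ exists), and $$\hat{\boldsymbol I}^{(\mu)}_{ij}=\sum_{l=0}^N\frac{l!}{\Gamma(l+\mu+1)}\,\hat s_{lj}\,P_l^{(-\mu,\mu)}(x_i),\qquad 0\le i,j\le N,$$ where $$\hat s_{lj}=\sum_{n=l}^N {}^{(\alpha,\beta)}C_{ln}^{(0,0)}\,t_{nj},\qquad t_{nj}=\frac{\omega_j}{\tilde\gamma_n^{(\alpha,\beta)}}P_n^{(\alpha,\beta)}(x_j),$$ with the Jacobi-to-Legendre connection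 coefficients $${}^{(\alpha,\beta)}C_{ln}^{(0,0)}=\frac1{\gamma_l^{(0,0)}}\int_{-1}^1P_l^{(0,0)}(x)\,P_n^{(\alpha,\beta)}(x)\,dx,$$ and $\tilde\gamma_n^{(\alpha,\beta)}=\gamma_n^{(\alpha,\beta)}$ for $0\le n\le N-1$, $\tilde\gamma_N^{(\alpha,\beta)}=\big(2+\frac{\alpha+\beta+1}N\big)\gamma_N^{(\alpha,\beta)}$. In particular, if $\alpha=\beta=0$, then $\hat s_{lj}=t_{lj}$ for all $0\le l,j\le N$. -/

import Mathlib

namespace JacobiFrac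

open Filter Topology Polynomial

noncomputable section

/-- The Jacobi polynomial `P_n^{(α,β)}` in Szegő's normalization,
`Γ(n+α+1)/(n! Γ(α+1)) · ₂F₁(-n, n+α+β+1; α+1; (1-x)/2)`, with the terminating series written out as
`(1/n!) ∑_{k=0}^n C(n,k) (n+α+β+1)_k (α+k+1)_{n-k} ((x-1)/2)^k`
(`(a)_k` is the rising factorial), which makes sense for all real `α`, `β`. -/
def jacobi (α β : ℝ) (n : ℕ) : ℝ[X] :=
  C ((n.factorial : ℝ)⁻¹) * ∑ k ∈ Finset.range (n + 1),
    C ((n.choose k : ℝ) * (ascPochhammer ℝ k).eval ((n : ℝ) + α + β + 1)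
      * (ascPochhammer ℝ (n - k)).eval (α + k + 1)) * (C (2⁻¹ : ℝ) * (X - 1)) ^ k

/-- The Jacobi weight `ω^{(α,β)}(x) = (1-x)^α (1+x)^β`. -/
def jacobiWeight (α β x : ℝ) : ℝ := (1 - x) ^ α * (1 + x) ^ β

/-- The normalization constant `γ_n^{(α,β)}`. In the case `n = 0` the product
`(α+β+1) Γ(α+β+1)` in the denominator is written as `Γ(α+β+2)`, so that `α + β = -1` is covered. -/
def jacobiGamma (α β : ℝ) (n : ℕ) : ℝ :=
  if n = 0 then
    2 ^ (α + β + 1) * Real.Gamma (α + 1) * Real.Gamma (β + 1) / Real.Gamma (α + β + 2)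
  else
    2 ^ (α + β + 1) * Real.Gamma (n + α + 1) * Real.Gamma (n + β + 1) /
      ((2 * n + α + β + 1) * n.factorial * Real.Gamma (n + α + β + 1))

/-- The discrete normalization constant `γ̃_n^{(α,β)}`, `0 ≤ n ≤ N`. -/
def jacobiGammaTilde (N : ℕ) (α β : ℝ) (n : ℕ) : ℝ :=
  if n = N then (2 + (α + β + 1) / N) * jacobiGamma α β N else jacobiGamma α β n

/-- `x 0 < x 1 < ⋯ < x N` are the Jacobi-Gauss-Lobatto points: all the real zeros of
`(1-x²) D P_N^{(α,β)}(x)`, in ascending order. -/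
structure IsJGLNodes (N : ℕ) (α β : ℝ) (x : Fin (N + 1) → ℝ) : Prop where
  strictMono : StrictMono x
  isRoot_iff : ∀ y : ℝ, ((1 - X ^ 2) * derivative (jacobi α β N)).IsRoot y ↔ ∃ j, x j = y

/-- The Lagrange interpolating basis polynomial `h_j` at the nodes `x`. -/
def lagrangeBasis {N : ℕ} (x : Fin (N + 1) → ℝ) (j : Fin (N + 1)) : ℝ[X] :=
  Lagrange.basis Finset.univ x j

/-- The weight `ω_j` of the interpolatory quadrature rule with nodes `x` for the weight function
`ω^{(α,β)}` on `(-1,1)`. -/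
def quadWeight {N : ℕ} (α β : ℝ) (x : Fin (N + 1) → ℝ) (j : Fin (N + 1)) : ℝ :=
  ∫ y in (-1 : ℝ)..1, (lagrangeBasis x j).eval y * jacobiWeight α β y

/-- `t_{nj} = ω_j P_n^{(α,β)}(x_j) / γ̃_n^{(α,β)}`. -/
def tCoeff {N : ℕ} (α β : ℝ) (x : Fin (N + 1) → ℝ) (n : ℕ) (j : Fin (N + 1)) : ℝ :=
  quadWeight α β x j / jacobiGammaTilde N α β n * (jacobi α β n).eval (x j)

/-- The connection coefficient `^{(α,β)}C_{ln}^{(a,b)}` of the transform from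
`{P_n^{(α,β)}}` to `{P_l^{(a,b)}}`. -/
def connCoeff (α β a b : ℝ) (l n : ℕ) : ℝ :=
  1 / jacobiGamma a b l *
    ∫ y in (-1 : ℝ)..1, (jacobi a b l).eval y * (jacobi α β n).eval y * jacobiWeight a b y

/-- `ŝ_{lj} = ∑_{n=l}^N ^{(α,β)}C_{ln}^{(0,0)} t_{nj}`. -/
def sHat {N : ℕ} (α β : ℝ) (x : Fin (N + 1) → ℝ) (l : ℕ) (j : Fin (N + 1)) : ℝ :=
  ∑ n ∈ Finset.Icc l N, connCoeff α β 0 0 l n * tCoeff α β x n j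

/-- The left-sided fractional integral of order `ρ > 0` from the end point `-1`:
`(I_-^ρ u)(x) = (1/Γ(ρ)) ∫_{-1}^x u(y) / (x-y)^{1-ρ} dy`. -/
def fracInt (ρ : ℝ) (u : ℝ → ℝ) (x : ℝ) : ℝ :=
  1 / Real.Gamma ρ * ∫ y in (-1 : ℝ)..x, u y / (x - y) ^ (1 - ρ)

/-- The modified fractional integral `(Î_-^ρ u)(x) = (1+x)^{-ρ} (I_-^ρ u)(x)`; its value at the
end point `x = -1` is the limit from the right. -/
def modFracInt (ρ : ℝ) (u : ℝ → ℝ) (x : ℝ) : ℝ :=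
  if x = -1 then limUnder (𝓝[>] (-1 : ℝ)) (fun y => (1 + y) ^ (-ρ) * fracInt ρ u y)
  else (1 + x) ^ (-ρ) * fracInt ρ u x

/-- The modified fractional integral matrix `Î^{(μ)}`, with entries `(Î_-^μ h_j)(x_i)`. -/
def modFracIntMatrix {N : ℕ} (μ : ℝ) (x : Fin (N + 1) → ℝ) :
    Matrix (Fin (N + 1)) (Fin (N + 1)) ℝ :=
  Matrix.of fun i j => modFracInt μ (fun y => (lagrangeBasis x j).eval y) (x i)

end

end JacobiFrac

open JacobiFrac Filter Topology

namespace JacobiFrac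

open Polynomial MeasureTheory

/-! ### The beta integral on a real interval -/

/-! The proof expands `h_j` in Legendre polynomials and integrates term by term.

For the expansion, start from the Jacobi basis. JGL quadrature is exact below degree `2N`
(`wInt_eq_quad`), so for `n < N` the Fourier coefficient of `h_j` is a quadrature sum, which
collapses to the node `x_j` and gives `t_{nj}`. For `n = N` the product has degree `2N` and
exactness fails; there one uses discrete orthogonality together with the discrete norm of `P_N`
(`quad_jacobi_mul_self`), which is where `γ̃_N` comes from. Re-expanding each Jacobi polynomial in
Legendre polynomials turns `t_{nj}` into `ŝ_{lj}`.

For the integration, the beta integral shows that `(1+x)^{-μ} I^μ` acts diagonally on powers of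
`(1+x)/2`, with multipliers `k!/Γ(k+μ+1)`. Expanding about `-1`, these multipliers send Legendre
coefficients to those of `P_l^{(-μ,μ)}`, up to `l!/Γ(l+μ+1)` (`fracInt_legendre`). The outcome is a
polynomial on `(-1,∞)`, so the limit at `-1` is its value there.

Orthogonality and norms also come from beta integrals, through alternating binomial sums. -/

theorem intervalIntegrable_rpow_mul_rpow {p q u v : ℝ} (hpq : p < q) (hu : -1 < u) (hv : -1 < v) :
    IntervalIntegrable (fun y => (q - y) ^ u * (y - p) ^ v) volume p q := by
  -- Cutting at an interior point leaves a single endpoint singularity on each piece.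
  obtain ⟨m, hpm, hmq⟩ := exists_between hpq
  have h1 : IntervalIntegrable (fun y => (y - p) ^ v) volume p m := by
    have := (intervalIntegral.intervalIntegrable_rpow' (a := 0) (b := m - p) hv).comp_sub_right p
    simpa using this
  have h2 : IntervalIntegrable (fun y => (q - y) ^ u) volume m q := by
    have := (intervalIntegral.intervalIntegrable_rpow' (a := q - m) (b := 0) hu).comp_sub_left q
    simpa using this
  refine IntervalIntegrable.trans (b := m) (h1.continuousOn_mul ?_) (h2.mul_continuousOn ?_)
  · refine ContinuousOn.rpow_const (by fun_prop) fun y hy => Or.inl ?_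
    rw [Set.uIcc_of_le hpm.le] at hy
    linarith [hy.2]
  · refine ContinuousOn.rpow_const (by fun_prop) fun y hy => Or.inl ?_
    rw [Set.uIcc_of_le hmq.le] at hy
    linarith [hy.1]

theorem integral_rpow_mul_rpow {p q u v : ℝ} (hpq : p < q) (hu : -1 < u) (hv : -1 < v) :
    ∫ y in p..q, (q - y) ^ u * (y - p) ^ v =
      (q - p) ^ (u + v + 1) * (Real.Gamma (u + 1) * Real.Gamma (v + 1) / Real.Gamma (u + v + 2)) := by
  have ha : 0 < q - p := sub_pos.2 hpq
  have hs := Complex.betaIntegral_scaled ((v + 1 : ℝ) : ℂ) ((u + 1 : ℝ) : ℂ) ha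
  rw [Complex.betaIntegral_eq_Gamma_mul_div _ _ (by simpa using by linarith)
    (by simpa using by linarith), ← Complex.ofReal_add, Complex.Gamma_ofReal, Complex.Gamma_ofReal,
    Complex.Gamma_ofReal] at hs
  have hint : ∫ x in (0 : ℝ)..(q - p), (x : ℂ) ^ (((v + 1 : ℝ) : ℂ) - 1) *
      (((q - p : ℝ) : ℂ) - x) ^ (((u + 1 : ℝ) : ℂ) - 1) =
      ((∫ x in (0 : ℝ)..(q - p), (q - p - x) ^ u * x ^ v : ℝ) : ℂ) := by
    rw [← intervalIntegral.integral_ofReal]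
    refine intervalIntegral.integral_congr fun x hx => ?_
    rw [Set.uIcc_of_le ha.le] at hx
    have e1 : ((v + 1 : ℝ) : ℂ) - 1 = (v : ℂ) := by push_cast; ring
    have e2 : ((u + 1 : ℝ) : ℂ) - 1 = (u : ℂ) := by push_cast; ring
    simp only [e1, e2]
    rw [← Complex.ofReal_sub, ← Complex.ofReal_cpow hx.1, ← Complex.ofReal_cpow (by linarith [hx.2]),
      ← Complex.ofReal_mul, mul_comm]
  rw [hint] at hs
  rw [← Complex.ofReal_one, ← Complex.ofReal_sub, ← Complex.ofReal_cpow ha.le] at hs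
  norm_cast at hs
  have hshift : ∫ y in p..q, (q - y) ^ u * (y - p) ^ v =
      ∫ x in (0 : ℝ)..(q - p), (q - p - x) ^ u * x ^ v := by
    have := intervalIntegral.integral_comp_sub_right (a := p) (b := q)
      (fun x => (q - p - x) ^ u * x ^ v) p
    rw [sub_self] at this
    rw [← this]
    refine intervalIntegral.integral_congr fun x _ => ?_
    simp
  rw [hshift, hs]
  congr 1
  · congr 1; ring
  · rw [mul_comm (Real.Gamma (v + 1))]; congr 2; ring

/-! ### The weighted integral of a polynomial -/

/-- The integral of a polynomial against the Jacobi weight. -/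
noncomputable def wInt (a b : ℝ) (p : ℝ[X]) : ℝ :=
  ∫ y in (-1 : ℝ)..1, p.eval y * jacobiWeight a b y

theorem intervalIntegrable_jacobiWeight {a b : ℝ} (ha : -1 < a) (hb : -1 < b) (p : ℝ[X]) :
    IntervalIntegrable (fun y => p.eval y * jacobiWeight a b y) volume (-1) 1 := by
  have h := intervalIntegrable_rpow_mul_rpow (p := -1) (q := 1) (by norm_num) ha hb
  refine IntervalIntegrable.continuousOn_mul ?_ p.continuous.continuousOn
  refine h.congr fun y _ => ?_
  simp [jacobiWeight, add_comm]

variable {a b : ℝ}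

theorem wInt_add (ha : -1 < a) (hb : -1 < b) (p q : ℝ[X]) :
    wInt a b (p + q) = wInt a b p + wInt a b q := by
  simp only [wInt, eval_add, add_mul]
  exact intervalIntegral.integral_add (intervalIntegrable_jacobiWeight ha hb p)
    (intervalIntegrable_jacobiWeight ha hb q)

theorem wInt_C_mul (c : ℝ) (p : ℝ[X]) : wInt a b (C c * p) = c * wInt a b p := by
  simp only [wInt, eval_mul, eval_C, mul_assoc]
  exact intervalIntegral.integral_const_mul _ _

theorem wInt_sub (ha : -1 < a) (hb : -1 < b) (p q : ℝ[X]) :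
    wInt a b (p - q) = wInt a b p - wInt a b q := by
  have := wInt_add ha hb p (C (-1) * q)
  rw [wInt_C_mul] at this
  rw [sub_eq_add_neg, sub_eq_add_neg, ← neg_one_mul (wInt a b q), ← this]
  simp

theorem wInt_zero : wInt a b 0 = 0 := by simp [wInt]

theorem wInt_sum (ha : -1 < a) (hb : -1 < b) {ι : Type*} (s : Finset ι) (f : ι → ℝ[X]) :
    wInt a b (∑ i ∈ s, f i) = ∑ i ∈ s, wInt a b (f i) := by
  classical
  induction s using Finset.induction_on with
  | empty => simp [wInt_zero]
  | insert i s hi ih => rw [Finset.sum_insert hi, Finset.sum_insert hi, wInt_add ha hb, ih]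

theorem wInt_comp_neg_X (p : ℝ[X]) : wInt a b (p.comp (-X)) = wInt b a p := by
  have := intervalIntegral.integral_comp_neg (a := -1) (b := 1)
    (fun y => p.eval y * jacobiWeight b a y)
  rw [neg_neg] at this
  rw [wInt, wInt, ← this]
  refine intervalIntegral.integral_congr fun y _ => ?_
  simp only [eval_comp, eval_neg, eval_X, jacobiWeight, sub_neg_eq_add, ← sub_eq_add_neg]
  rw [mul_comm ((1 - y) ^ a)]

theorem wInt_add_one_add_one (p : ℝ[X]) :
    wInt (a + 1) (b + 1) p = wInt a b ((1 - X ^ 2) * p) := by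
  -- Only interior points are compared: at a zero base, `rpow` need not satisfy `t ^ (a + 1) = t ^ a
  -- * t`.
  refine intervalIntegral.integral_congr_Ioo_of_le (by norm_num) fun y hy => ?_
  have h1 : 1 - y ≠ 0 := by linarith [hy.2]
  have h2 : 1 + y ≠ 0 := by linarith [hy.1]
  simp only [jacobiWeight, Real.rpow_add_one h1, Real.rpow_add_one h2, eval_mul, eval_sub, eval_one,
    eval_pow, eval_X]
  ring

/-- `(X - 1) / 2`. -/
noncomputable def halfSub : ℝ[X] := C (2⁻¹ : ℝ) * (X - 1)

/-- `(X + 1) / 2`. -/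
noncomputable def halfAdd : ℝ[X] := C (2⁻¹ : ℝ) * (X + 1)

theorem halfSub_add_one : halfSub + 1 = halfAdd := by
  have : (1 : ℝ[X]) = C (2⁻¹ : ℝ) * C 2 := by rw [← C_mul]; norm_num
  rw [halfSub, halfAdd]
  nth_rewrite 2 [this]
  rw [← mul_add]
  congr 1
  have : (C 2 : ℝ[X]) = 2 := rfl
  rw [this]; ring

theorem halfSub_comp_neg_X : halfSub.comp (-X) = -halfAdd := by
  simp only [halfSub, halfAdd, mul_comp, C_comp, sub_comp, X_comp, one_comp]
  ring

theorem wInt_halfSub_pow_mul_halfAdd_pow (ha : -1 < a) (hb : -1 < b) (k m : ℕ) :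
    wInt a b (halfSub ^ k * halfAdd ^ m) =
      (-1) ^ k * 2 ^ (a + b + 1) * (Real.Gamma (a + k + 1) * Real.Gamma (b + m + 1) /
        Real.Gamma (a + b + k + m + 2)) := by
  have hk : (0 : ℝ) ≤ k := k.cast_nonneg
  have hm : (0 : ℝ) ≤ m := m.cast_nonneg
  have h := integral_rpow_mul_rpow (p := -1) (q := 1) (u := a + k) (v := b + m) (by norm_num)
    (by linarith) (by linarith)
  have hc : wInt a b (halfSub ^ k * halfAdd ^ m) =
      ∫ y in (-1 : ℝ)..1, ((-1) ^ k * (2⁻¹) ^ (k + m)) *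
        ((1 - y) ^ (a + k) * (y - -1) ^ (b + m)) := by
    refine intervalIntegral.integral_congr_Ioo_of_le (by norm_num) fun y hy => ?_
    have h1 : 1 - y ≠ 0 := by linarith [hy.2]
    have h2 : 1 + y ≠ 0 := by linarith [hy.1]
    have h3 : y - -1 = 1 + y := by ring
    have h4 : y - 1 = (-1) * (1 - y) := by ring
    simp only [h3, jacobiWeight, Real.rpow_add_natCast h1, Real.rpow_add_natCast h2, halfSub,
      halfAdd, eval_mul, eval_sub, eval_one, eval_add, eval_pow, eval_X, eval_C, mul_pow, h4]
    ring
  rw [hc, intervalIntegral.integral_const_mul, h]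
  have h5 : (1 - -1 : ℝ) ^ (a + k + (b + m) + 1) = 2 ^ (a + b + 1) * 2 ^ (k + m) := by
    rw [← Real.rpow_add_natCast (by norm_num)]
    norm_num
    congr 1
    ring
  rw [h5, show a + k + (b + m) + 2 = a + b + k + m + 2 by ring, inv_pow]
  have : (2 : ℝ) ^ (k + m) ≠ 0 := by positivity
  field_simp

/-! ### Pochhammer symbols -/

theorem Gamma_add_nat {z : ℝ} (hz : 0 < z) (n : ℕ) :
    Real.Gamma (z + n) = (ascPochhammer ℝ n).eval z * Real.Gamma z := by
  induction n with
  | zero => simp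
  | succ n ih =>
    have : z + n ≠ 0 := by positivity
    rw [Nat.cast_succ, ← add_assoc, Real.Gamma_add_one this, ih, ascPochhammer_succ_eval]
    ring

theorem ascPochhammer_succ_eval_left (n : ℕ) (z : ℝ) :
    (ascPochhammer ℝ (n + 1)).eval z = z * (ascPochhammer ℝ n).eval (z + 1) := by
  simp [ascPochhammer_succ_left]

/-- Up to sign, the sum is the `n`-th forward difference of `q` at `0`. -/
theorem sum_alternating_choose_mul_eval {n : ℕ} {q : ℝ[X]} (hq : q.natDegree < n) :
    ∑ k ∈ Finset.range (n + 1), (-1 : ℝ) ^ k * n.choose k * q.eval (k : ℝ) = 0 := by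
  have h := congrFun (Polynomial.fwdDiff_iter_eq_zero_of_degree_lt hq) 0
  rw [fwdDiff_iter_eq_sum_shift] at h
  have h' : ∑ k ∈ Finset.range (n + 1), (-1 : ℝ) ^ n *
      ((-1 : ℝ) ^ (n - k) * n.choose k * q.eval (k : ℝ)) = 0 := by
    rw [← Finset.mul_sum]
    simp only [zsmul_eq_mul, nsmul_eq_mul, Pi.zero_apply] at h
    push_cast at h
    simp only [zero_add, mul_one] at h
    rw [h, mul_zero]
  rw [← h']
  refine Finset.sum_congr rfl fun k hk => ?_
  have hk' : k ≤ n := Nat.lt_succ_iff.1 (Finset.mem_range.1 hk)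
  have : (-1 : ℝ) ^ n * (-1) ^ (n - k) = (-1) ^ k := by
    obtain ⟨d, rfl⟩ := Nat.exists_eq_add_of_le hk'
    rw [Nat.add_sub_cancel_left, pow_add, mul_assoc, ← mul_pow]
    simp
  rw [← this]
  ring

/-- The partial fraction decomposition of `n! / (z)_{n+1}`. By Pascal's rule, the sum for `n + 1` at
`z` is the difference of the sums for `n` at `z` and `z + 1`. -/
theorem sum_alternating_choose_div (n : ℕ) : ∀ z : ℝ, 0 < z →
    ∑ k ∈ Finset.range (n + 1), (-1 : ℝ) ^ k * n.choose k * (z + k)⁻¹ =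
      n.factorial / (ascPochhammer ℝ (n + 1)).eval z := by
  induction n with
  | zero => intro z hz; simp
  | succ n ih =>
    intro z hz
    have key : ∑ k ∈ Finset.range (n + 1 + 1), (-1 : ℝ) ^ k * (n + 1).choose k * (z + k)⁻¹ =
        ∑ k ∈ Finset.range (n + 1), (-1 : ℝ) ^ k * n.choose k * (z + k)⁻¹ -
        ∑ k ∈ Finset.range (n + 1), (-1 : ℝ) ^ k * n.choose k * (z + 1 + k)⁻¹ := by
      rw [Finset.sum_range_succ']
      have h0 : ∑ k ∈ Finset.range (n + 1), (-1 : ℝ) ^ k * n.choose k * (z + k)⁻¹ =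
          ∑ k ∈ Finset.range (n + 1),
            (-1 : ℝ) ^ (k + 1) * n.choose (k + 1) * (z + (k + 1 : ℕ))⁻¹ + (z + (0 : ℕ))⁻¹ := by
        have := Finset.sum_range_succ' (fun k : ℕ => (-1 : ℝ) ^ k * n.choose k * (z + k)⁻¹) (n + 1)
        rw [Finset.sum_range_succ] at this
        simpa using this
      rw [h0]
      have : ∀ k ∈ Finset.range (n + 1),
          (-1 : ℝ) ^ (k + 1) * (n + 1).choose (k + 1) * (z + (k + 1 : ℕ))⁻¹ =
          (-1 : ℝ) ^ (k + 1) * n.choose (k + 1) * (z + (k + 1 : ℕ))⁻¹ -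
          (-1 : ℝ) ^ k * n.choose k * (z + 1 + k)⁻¹ := by
        intro k _
        rw [Nat.choose_succ_succ]
        push_cast
        rw [show z + 1 + (k : ℝ) = z + (k + 1) by ring]
        ring
      rw [Finset.sum_congr rfl this, Finset.sum_sub_distrib]
      simp
      ring
    rw [key, ih z hz, ih (z + 1) (by linarith)]
    have h1 := ascPochhammer_succ_eval (S := ℝ) (n + 1) z
    have h2 := ascPochhammer_succ_eval_left (n + 1) z
    have p1 := ascPochhammer_pos (n + 1) z hz
    have p2 := ascPochhammer_pos (n + 1) (z + 1) (by linarith)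
    have p3 := ascPochhammer_pos (n + 1 + 1) z hz
    rw [Nat.factorial_succ]
    have hzn : z + ((n + 1 : ℕ) : ℝ) ≠ 0 := by positivity
    have e1 : (ascPochhammer ℝ (n + 1)).eval z =
        (ascPochhammer ℝ (n + 1 + 1)).eval z / (z + ((n + 1 : ℕ) : ℝ)) := by
      rw [h1]; field_simp
    have e2 : (ascPochhammer ℝ (n + 1)).eval (z + 1) =
        (ascPochhammer ℝ (n + 1 + 1)).eval z / z := by
      rw [h2]; field_simp
    rw [e1, e2]
    have := p3.ne'
    push_cast
    field_simp
    ring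

/-! ### Jacobi polynomials: coefficients, orthogonality -/

/-- The coefficient of `((X - 1) / 2) ^ k` in the Jacobi polynomial. -/
noncomputable def jacobiCoeff (a b : ℝ) (n k : ℕ) : ℝ :=
  (n.factorial : ℝ)⁻¹ * ((n.choose k : ℝ) * (ascPochhammer ℝ k).eval ((n : ℝ) + a + b + 1)
      * (ascPochhammer ℝ (n - k)).eval (a + k + 1))

theorem jacobi_eq_sum (a b : ℝ) (n : ℕ) :
    jacobi a b n = ∑ k ∈ Finset.range (n + 1), C (jacobiCoeff a b n k) * halfSub ^ k := by
  rw [jacobi, Finset.mul_sum]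
  refine Finset.sum_congr rfl fun k _ => ?_
  rw [jacobiCoeff, C_mul, C_mul, C_mul, C_mul, halfSub, C_mul]
  ring

/-- The Gamma factor from the beta integral completes `(a+k+1)_{n-k}` to `Γ(n+a+1)`, which no longer
depends on `k`. -/
theorem jacobiCoeff_mul_Gamma (ha : -1 < a) {n k : ℕ} (hk : k ≤ n) :
    jacobiCoeff a b n k * Real.Gamma (a + k + 1) = (n.factorial : ℝ)⁻¹ * Real.Gamma (n + a + 1) *
      (n.choose k * (ascPochhammer ℝ k).eval ((n : ℝ) + a + b + 1)) := by
  have h0 : (0 : ℝ) ≤ k := k.cast_nonneg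
  have h := Gamma_add_nat (z := a + k + 1) (by linarith) (n - k)
  rw [Nat.cast_sub hk, show a + (k : ℝ) + 1 + (n - k) = n + a + 1 by ring] at h
  rw [h, jacobiCoeff]
  ring

theorem wInt_jacobi_mul_halfAdd_pow (ha : -1 < a) (hb : -1 < b) (n m : ℕ) :
    wInt a b (jacobi a b n * halfAdd ^ m) =
      2 ^ (a + b + 1) * (n.factorial : ℝ)⁻¹ * Real.Gamma (n + a + 1) * Real.Gamma (b + m + 1) *
      ∑ k ∈ Finset.range (n + 1), (-1 : ℝ) ^ k * n.choose k *
        ((ascPochhammer ℝ k).eval ((n : ℝ) + a + b + 1) / Real.Gamma (a + b + k + m + 2)) := by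
  rw [jacobi_eq_sum, Finset.sum_mul, wInt_sum ha hb, Finset.mul_sum]
  refine Finset.sum_congr rfl fun k hk => ?_
  have h := jacobiCoeff_mul_Gamma (b := b) ha (Nat.lt_succ_iff.1 (Finset.mem_range.1 hk))
  rw [mul_assoc, wInt_C_mul, wInt_halfSub_pow_mul_halfAdd_pow ha hb]
  calc _ = (jacobiCoeff a b n k * Real.Gamma (a + k + 1)) * ((-1) ^ k * 2 ^ (a + b + 1) *
        Real.Gamma (b + m + 1) / Real.Gamma (a + b + k + m + 2)) := by ring
    _ = _ := by rw [h]; ring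

theorem wInt_jacobi_mul_halfAdd_pow_of_lt (ha : -1 < a) (hb : -1 < b) {n m : ℕ} (hm : m < n) :
    wInt a b (jacobi a b n * halfAdd ^ m) = 0 := by
  rw [wInt_jacobi_mul_halfAdd_pow ha hb]
  obtain ⟨d, rfl⟩ := Nat.exists_eq_add_of_lt hm
  set n := m + d + 1 with hn
  have hm0 : (0 : ℝ) ≤ m := m.cast_nonneg
  have hd0 : (0 : ℝ) ≤ d := d.cast_nonneg
  have hnc : (n : ℝ) = m + d + 1 := by rw [hn]; push_cast; ring
  have hpos : 0 < (n : ℝ) + a + b + 1 := by rw [hnc]; linarith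
  -- The quotient `Γ(n+a+b+1+k) / Γ(a+b+k+m+2)` is `(a+b+k+m+2)_d` with `d = n-m-1`, a polynomial in
  -- `k` of degree below `n`, so its alternating sum vanishes.
  set q : ℝ[X] := (ascPochhammer ℝ d).comp (X + C (a + b + m + 2)) with hq
  have hqd : q.natDegree < n := by
    have : q.natDegree = d := by
      rw [hq, natDegree_comp, natDegree_X_add_C, mul_one, ascPochhammer_natDegree]
    omega
  have hsum := sum_alternating_choose_mul_eval hqd
  have : ∀ k ∈ Finset.range (n + 1), (-1 : ℝ) ^ k * n.choose k *
        ((ascPochhammer ℝ k).eval ((n : ℝ) + a + b + 1) / Real.Gamma (a + b + k + m + 2)) =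
      (-1 : ℝ) ^ k * n.choose k * q.eval (k : ℝ) * (Real.Gamma ((n : ℝ) + a + b + 1))⁻¹ := by
    intro k _
    have hk0 : (0 : ℝ) ≤ k := k.cast_nonneg
    have h1 := Gamma_add_nat hpos k
    have hp2 : 0 < a + b + k + m + 2 := by linarith
    have h2 := Gamma_add_nat hp2 d
    rw [show a + b + k + m + 2 + (d : ℝ) = n + a + b + 1 + k by rw [hnc]; ring, h1] at h2
    have g1 := (Real.Gamma_pos_of_pos hpos).ne'
    have g2 := (Real.Gamma_pos_of_pos hp2).ne'
    have h3 : q.eval (k : ℝ) = (ascPochhammer ℝ d).eval (a + b + k + m + 2) := by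
      rw [hq, eval_comp]; congr 1; simp; ring
    have h4 : (ascPochhammer ℝ k).eval ((n : ℝ) + a + b + 1) / Real.Gamma (a + b + k + m + 2) =
        q.eval (k : ℝ) * (Real.Gamma ((n : ℝ) + a + b + 1))⁻¹ := by
      rw [h3]
      field_simp
      rw [h2, mul_comm]
    rw [h4]
    ring
  rw [Finset.sum_congr rfl this, ← Finset.sum_mul, hsum]
  simp

theorem wInt_jacobi_mul_halfAdd_pow_self (ha : -1 < a) (hb : -1 < b) (n : ℕ) :
    wInt a b (jacobi a b n * halfAdd ^ n) =
      2 ^ (a + b + 1) * Real.Gamma (n + a + 1) * Real.Gamma (n + b + 1) /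
        Real.Gamma (2 * n + a + b + 2) := by
  rw [wInt_jacobi_mul_halfAdd_pow ha hb]
  -- For `n = 0` the base point `a + b + 1` may be nonpositive, outside the range of the partial
  -- fraction identity.
  rcases Nat.eq_zero_or_pos n with rfl | hn
  · simp
    ring
  have hn1 : (1 : ℝ) ≤ n := by exact_mod_cast hn
  have hpos : 0 < (n : ℝ) + a + b + 1 := by linarith
  have g1 := (Real.Gamma_pos_of_pos hpos).ne'
  have : ∀ k ∈ Finset.range (n + 1), (-1 : ℝ) ^ k * n.choose k *
        ((ascPochhammer ℝ k).eval ((n : ℝ) + a + b + 1) / Real.Gamma (a + b + k + n + 2)) =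
      (-1 : ℝ) ^ k * n.choose k * ((n : ℝ) + a + b + 1 + k)⁻¹ *
        (Real.Gamma ((n : ℝ) + a + b + 1))⁻¹ := by
    intro k _
    have hk0 : (0 : ℝ) ≤ k := k.cast_nonneg
    have h1 := Gamma_add_nat hpos k
    have hp2 : 0 < (n : ℝ) + a + b + 1 + k := by linarith
    have h2 := Real.Gamma_add_one hp2.ne'
    rw [h1, show (n : ℝ) + a + b + 1 + k + 1 = a + b + k + n + 2 by ring] at h2
    have hp := ascPochhammer_pos k _ hpos
    rw [h2]
    field_simp
  rw [Finset.sum_congr rfl this, ← Finset.sum_mul, sum_alternating_choose_div n _ hpos]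
  have h3 := Gamma_add_nat hpos (n + 1)
  rw [show (n : ℝ) + a + b + 1 + (n + 1 : ℕ) = 2 * n + a + b + 2 by push_cast; ring] at h3
  have hp := (ascPochhammer_pos (n + 1) _ hpos).ne'
  have hf : (n.factorial : ℝ) ≠ 0 := by positivity
  rw [h3, show b + (n : ℝ) + 1 = n + b + 1 by ring]
  field_simp

theorem eq_sum_halfAdd_pow {p : ℝ[X]} {n : ℕ} (hp : p.degree < n) :
    ∃ c : ℕ → ℝ, p = ∑ m ∈ Finset.range n, C (c m) * halfAdd ^ m := by
  -- `r` inverts the substitution `halfAdd`, so the coefficients sought are those of `p.comp r`.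
  set r : ℝ[X] := C 2 * X - 1 with hr
  have hcomp : r.comp halfAdd = X := by
    simp only [hr, halfAdd, sub_comp, mul_comp, C_comp, X_comp, one_comp]
    rw [← mul_assoc, ← C_mul]
    norm_num
  have hrd : r.degree = 1 := by
    rw [hr, show (1 : ℝ[X]) = C 1 from rfl, sub_eq_add_neg, ← C_neg]
    exact degree_linear (by norm_num)
  rcases eq_or_ne p 0 with rfl | hp0
  · exact ⟨0, by simp⟩
  have hq : (p.comp r).natDegree < n := by
    rw [natDegree_comp, natDegree_eq_of_degree_eq_some (n := 1) hrd, mul_one]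
    exact (natDegree_lt_iff_degree_lt hp0).2 hp
  refine ⟨(p.comp r).coeff, ?_⟩
  have h := congrArg (fun s => s.comp halfAdd) ((p.comp r).as_sum_range' n hq)
  simp only [comp_assoc, hcomp, comp_X] at h
  refine h.trans ?_
  rw [sum_comp]
  simp [monomial_comp]

theorem wInt_jacobi_mul_of_degree_lt (ha : -1 < a) (hb : -1 < b) {n : ℕ} {p : ℝ[X]}
    (hp : p.degree < n) : wInt a b (jacobi a b n * p) = 0 := by
  obtain ⟨c, rfl⟩ := eq_sum_halfAdd_pow hp
  rw [Finset.mul_sum, wInt_sum ha hb]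
  refine Finset.sum_eq_zero fun m hm => ?_
  rw [mul_left_comm, wInt_C_mul,
    wInt_jacobi_mul_halfAdd_pow_of_lt ha hb (Finset.mem_range.1 hm), mul_zero]

theorem degree_halfSub_pow_le (k : ℕ) : (halfSub ^ k).degree ≤ k := by
  have : halfSub.degree ≤ 1 := by
    rw [halfSub]
    rw [degree_C_mul (by norm_num), show (1 : ℝ[X]) = C 1 from rfl, degree_X_sub_C]
  refine (degree_pow_le _ _).trans ?_
  calc k • halfSub.degree ≤ k • (1 : WithBot ℕ) := by gcongr
    _ = k := by simp

theorem degree_sum_halfSub_pow_lt (c : ℕ → ℝ) (n : ℕ) :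
    (∑ k ∈ Finset.range n, C (c k) * halfSub ^ k).degree < n := by
  refine mem_degreeLT.1 (Submodule.sum_mem _ fun k hk => ?_)
  rw [C_mul']
  exact Submodule.smul_mem _ _ (mem_degreeLT.2 ((degree_halfSub_pow_le k).trans_lt
    (by exact_mod_cast Finset.mem_range.1 hk)))

/-- The leading coefficient of the Jacobi polynomial with respect to `(X ± 1) / 2`. -/
noncomputable def jacobiLead (a b : ℝ) (n : ℕ) : ℝ :=
  (n.factorial : ℝ)⁻¹ * (ascPochhammer ℝ n).eval ((n : ℝ) + a + b + 1)

theorem jacobiLead_pos (ha : -1 < a) (hb : -1 < b) (n : ℕ) : 0 < jacobiLead a b n := by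
  rw [jacobiLead]
  rcases Nat.eq_zero_or_pos n with rfl | hn
  · simp
  have hn1 : (1 : ℝ) ≤ n := by exact_mod_cast hn
  have := ascPochhammer_pos n ((n : ℝ) + a + b + 1) (by linarith)
  positivity

theorem exists_jacobi_eq_halfAdd_pow_add (a b : ℝ) (n : ℕ) : ∃ r : ℝ[X], r.degree < n ∧
    jacobi a b n = C (jacobiLead a b n) * halfAdd ^ n + r := by
  have hl : jacobiCoeff a b n n = jacobiLead a b n := by simp [jacobiCoeff, jacobiLead]
  refine ⟨∑ k ∈ Finset.range n,
    C (jacobiCoeff a b n k - jacobiLead a b n * n.choose k) * halfSub ^ k,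
    degree_sum_halfSub_pow_lt _ n, ?_⟩
  rw [jacobi_eq_sum, Finset.sum_range_succ, hl, ← halfSub_add_one, add_pow, Finset.sum_range_succ]
  simp only [C_sub, sub_mul, Finset.sum_sub_distrib, mul_add, Finset.mul_sum, C_mul]
  simp
  have : ∀ k ∈ Finset.range n, C (jacobiLead a b n) * (halfSub ^ k * (n.choose k : ℝ[X])) =
      C (jacobiLead a b n) * (n.choose k : ℝ[X]) * halfSub ^ k := fun k _ => by ring
  rw [Finset.sum_congr rfl this]
  ring

theorem degree_jacobi_lt (a b : ℝ) (n : ℕ) : (jacobi a b n).degree < (n + 1 : ℕ) := by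
  rw [jacobi_eq_sum]
  exact degree_sum_halfSub_pow_lt _ _

theorem coeff_halfAdd_pow (n : ℕ) : (halfAdd ^ n).coeff n = (2⁻¹ : ℝ) ^ n := by
  rw [halfAdd, mul_pow, ← C_pow, coeff_C_mul, show (1 : ℝ[X]) = C 1 from rfl]
  have h := (monic_X_add_C (1 : ℝ)).pow n
  have h2 := h.coeff_natDegree
  rw [natDegree_pow, natDegree_X_add_C, mul_one] at h2
  rw [h2, mul_one]

theorem coeff_jacobi (a b : ℝ) (n : ℕ) :
    (jacobi a b n).coeff n = jacobiLead a b n * (2⁻¹ : ℝ) ^ n := by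
  obtain ⟨r, hr, h⟩ := exists_jacobi_eq_halfAdd_pow_add a b n
  rw [h, coeff_add, coeff_C_mul, coeff_halfAdd_pow, coeff_eq_zero_of_degree_lt hr, add_zero]

theorem degree_jacobi (ha : -1 < a) (hb : -1 < b) (n : ℕ) : (jacobi a b n).degree = n := by
  have h := degree_jacobi_lt a b n
  rw [degree_lt_iff_coeff_zero] at h
  refine le_antisymm ((degree_le_iff_coeff_zero _ _).2 fun m hm => h m ?_)
    (le_degree_of_ne_zero ?_)
  · exact_mod_cast hm
  rw [coeff_jacobi]
  have := jacobiLead_pos ha hb n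
  positivity

/-- By orthogonality only the leading term of one factor contributes, which reduces the norm to the
moment against `halfAdd ^ n`. -/
theorem wInt_jacobi_mul_self (ha : -1 < a) (hb : -1 < b) (n : ℕ) :
    wInt a b (jacobi a b n * jacobi a b n) = jacobiGamma a b n := by
  obtain ⟨r, hr, h⟩ := exists_jacobi_eq_halfAdd_pow_add a b n
  have h1 : wInt a b (jacobi a b n * jacobi a b n) =
      jacobiLead a b n * wInt a b (jacobi a b n * halfAdd ^ n) := by
    nth_rewrite 2 [h]
    rw [mul_add, wInt_add ha hb, wInt_jacobi_mul_of_degree_lt ha hb hr, mul_left_comm, wInt_C_mul,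
      add_zero]
  rw [h1, wInt_jacobi_mul_halfAdd_pow_self ha hb, jacobiLead, jacobiGamma]
  split_ifs with hn
  · subst hn; simp
  have hn1 : (1 : ℝ) ≤ n := by exact_mod_cast Nat.pos_of_ne_zero hn
  have hpos : 0 < (n : ℝ) + a + b + 1 := by linarith
  have hpos2 : 0 < 2 * (n : ℝ) + a + b + 1 := by linarith
  have h3 := Gamma_add_nat hpos n
  have h4 := Real.Gamma_add_one hpos2.ne'
  rw [show (n : ℝ) + a + b + 1 + n = 2 * n + a + b + 1 by ring] at h3
  rw [h3, show 2 * (n : ℝ) + a + b + 1 + 1 = 2 * n + a + b + 2 by ring] at h4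
  have hp := (ascPochhammer_pos n _ hpos).ne'
  have g1 := (Real.Gamma_pos_of_pos hpos).ne'
  rw [h4]
  field_simp

theorem jacobiGamma_pos (ha : -1 < a) (hb : -1 < b) (n : ℕ) : 0 < jacobiGamma a b n := by
  have hn : (0 : ℝ) ≤ n := n.cast_nonneg
  have g1 := Real.Gamma_pos_of_pos (s := n + a + 1) (by linarith)
  have g2 := Real.Gamma_pos_of_pos (s := n + b + 1) (by linarith)
  have g3 := Real.Gamma_pos_of_pos (s := 2 * n + a + b + 2) (by linarith)
  have hl := jacobiLead_pos ha hb n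
  obtain ⟨r, hr, h⟩ := exists_jacobi_eq_halfAdd_pow_add a b n
  rw [← wInt_jacobi_mul_self ha hb]
  nth_rewrite 2 [h]
  rw [mul_add, wInt_add ha hb, wInt_jacobi_mul_of_degree_lt ha hb hr, mul_left_comm, wInt_C_mul,
    add_zero, wInt_jacobi_mul_halfAdd_pow_self ha hb]
  positivity

theorem wInt_jacobi_mul_jacobi (ha : -1 < a) (hb : -1 < b) (m n : ℕ) :
    wInt a b (jacobi a b m * jacobi a b n) = if m = n then jacobiGamma a b n else 0 := by
  split_ifs with h
  · subst h; exact wInt_jacobi_mul_self ha hb m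
  rcases lt_or_gt_of_ne h with h | h
  · rw [mul_comm]
    exact wInt_jacobi_mul_of_degree_lt ha hb
      ((degree_jacobi ha hb m).trans_lt (by exact_mod_cast h))
  · exact wInt_jacobi_mul_of_degree_lt ha hb
      ((degree_jacobi ha hb n).trans_lt (by exact_mod_cast h))

theorem degree_sub_C_mul_lt {p q : ℝ[X]} {n : ℕ} {c : ℝ} (hp : p.degree < (n + 1 : ℕ))
    (hq : q.degree < (n + 1 : ℕ)) (h : p.coeff n = c * q.coeff n) : (p - C c * q).degree < n := by
  rw [degree_lt_iff_coeff_zero] at hp hq ⊢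
  intro m hm
  rw [coeff_sub, coeff_C_mul]
  rcases hm.eq_or_lt with rfl | hm
  · rw [h, sub_self]
  · rw [hp m hm, hq m hm, mul_zero, sub_self]

theorem exists_eq_sum_jacobi (ha : -1 < a) (hb : -1 < b) (n : ℕ) : ∀ p : ℝ[X], p.degree < n →
    ∃ c : ℕ → ℝ, p = ∑ m ∈ Finset.range n, C (c m) * jacobi a b m := by
  induction n with
  | zero => intro p hp; exact ⟨0, by simpa using hp⟩
  | succ n ih =>
    intro p hp
    have hne : (jacobi a b n).coeff n ≠ 0 := by
      rw [coeff_jacobi]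
      have := jacobiLead_pos ha hb n
      positivity
    obtain ⟨c, hc⟩ := ih (p - C (p.coeff n / (jacobi a b n).coeff n) * jacobi a b n)
      (degree_sub_C_mul_lt hp (degree_jacobi_lt a b n) (by field_simp))
    refine ⟨fun m => if m = n then p.coeff n / (jacobi a b n).coeff n else c m, ?_⟩
    simp only [Finset.sum_range_succ, if_true]
    rw [← sub_eq_iff_eq_add, hc]
    exact Finset.sum_congr rfl fun m hm => by rw [if_neg (Finset.mem_range.1 hm).ne]

/-- The expansion of a polynomial in Jacobi polynomials. -/
theorem eq_sum_wInt_jacobi (ha : -1 < a) (hb : -1 < b) {n : ℕ} {p : ℝ[X]} (hp : p.degree < n) :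
    p = ∑ m ∈ Finset.range n, C (wInt a b (p * jacobi a b m) / jacobiGamma a b m) *
      jacobi a b m := by
  obtain ⟨c, hc⟩ := exists_eq_sum_jacobi ha hb n p hp
  have : ∀ m ∈ Finset.range n, wInt a b (p * jacobi a b m) / jacobiGamma a b m = c m := by
    intro m hm
    rw [hc, Finset.sum_mul, wInt_sum ha hb, Finset.sum_eq_single_of_mem m hm, mul_assoc, wInt_C_mul,
      wInt_jacobi_mul_self ha hb, mul_div_assoc, div_self (jacobiGamma_pos ha hb m).ne', mul_one]
    intro k _ hk
    rw [mul_assoc, wInt_C_mul, wInt_jacobi_mul_jacobi ha hb, if_neg hk, mul_zero]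
  nth_rewrite 1 [hc]
  exact Finset.sum_congr rfl fun m hm => by rw [this m hm]

/-- Both sides have the same leading coefficient and are orthogonal to all lower degrees. Their
difference has degree below `n` and is orthogonal to everything of that degree, hence is zero. -/
theorem jacobi_comp_neg_X (ha : -1 < a) (hb : -1 < b) (n : ℕ) :
    (jacobi b a n).comp (-X) = C ((-1) ^ n) * jacobi a b n := by
  have hdeg : ((jacobi b a n).comp (-X)).degree < (n + 1 : ℕ) := by
    rw [degree_comp_neg_X]
    exact degree_jacobi_lt b a n
  have hco : ((jacobi b a n).comp (-X)).coeff n = (-1) ^ n * (jacobi a b n).coeff n := by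
    rw [show (-X : ℝ[X]) = C (-1) * X by simp, comp_C_mul_X_coeff, coeff_jacobi, coeff_jacobi,
      jacobiLead, jacobiLead, add_right_comm _ b a]
    ring
  have hd := degree_sub_C_mul_lt hdeg (degree_jacobi_lt a b n) hco
  rw [← sub_eq_zero, eq_sum_wInt_jacobi ha hb hd]
  refine Finset.sum_eq_zero fun m hm => ?_
  have hmn : (jacobi a b m).degree < n := by
    rw [degree_jacobi ha hb]
    exact_mod_cast Finset.mem_range.1 hm
  have h1 : wInt a b ((jacobi b a n).comp (-X) * jacobi a b m) = 0 := by
    have : (jacobi b a n).comp (-X) * jacobi a b m =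
        (jacobi b a n * (jacobi a b m).comp (-X)).comp (-X) := by
      rw [mul_comp, comp_neg_X_comp_neg_X]
    rw [this, wInt_comp_neg_X]
    refine wInt_jacobi_mul_of_degree_lt hb ha ?_
    rw [degree_comp_neg_X]
    exact hmn
  rw [sub_mul, wInt_sub ha hb, h1, mul_assoc, wInt_C_mul, wInt_jacobi_mul_of_degree_lt ha hb hmn]
  simp

/-! ### Derivatives of Jacobi polynomials -/

theorem jacobiCoeff_succ_succ (a b : ℝ) (n k : ℕ) :
    jacobiCoeff a b (n + 1) (k + 1) * (k + 1) =
      (n + a + b + 2) * jacobiCoeff (a + 1) (b + 1) n k := by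
  have h1 : ((n : ℝ) + 1) * n.choose k = (n + 1).choose (k + 1) * (k + 1) := by
    exact_mod_cast Nat.add_one_mul_choose_eq n k
  have hn : (n : ℝ) + 1 ≠ 0 := by positivity
  have h2 : ((n + 1).choose (k + 1) : ℝ) = (n + 1) * n.choose k / (k + 1) := by
    rw [h1]; field_simp
  rw [jacobiCoeff, jacobiCoeff, Nat.factorial_succ, Nat.add_sub_add_right, h2,
    ascPochhammer_succ_eval_left]
  push_cast
  rw [show (n : ℝ) + 1 + a + b + 1 + 1 = n + (a + 1) + (b + 1) + 1 by ring,
    show a + ((k : ℝ) + 1) + 1 = a + 1 + k + 1 by ring]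
  field_simp
  ring

theorem derivative_jacobi_succ (a b : ℝ) (n : ℕ) :
    derivative (jacobi a b (n + 1)) = C ((n + a + b + 2) / 2) * jacobi (a + 1) (b + 1) n := by
  rw [jacobi_eq_sum, jacobi_eq_sum, derivative_sum, Finset.sum_range_succ', Finset.mul_sum]
  simp only [pow_zero, mul_one, derivative_C, add_zero]
  refine Finset.sum_congr rfl fun k _ => ?_
  have hd : derivative halfSub = C (2⁻¹ : ℝ) := by simp [halfSub]
  rw [derivative_C_mul, derivative_pow_succ, hd]
  have h := jacobiCoeff_succ_succ a b n k
  calc _ = C (jacobiCoeff a b (n + 1) (k + 1) * (k + 1) * 2⁻¹) * halfSub ^ k := by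
        simp only [C_mul, C_add, C_1]; ring
    _ = _ := by rw [h, ← mul_assoc, ← C_mul]; congr 2; ring

/-- The left side is the integral of `(1-x²) (P_{n+1}')²` against the weight, since `P_{n+1}'` is a
multiple of `P_n^{(a+1,b+1)}`. -/
theorem jacobiGamma_succ (ha : -1 < a) (hb : -1 < b) (n : ℕ) :
    ((n + a + b + 2) / 2) ^ 2 * jacobiGamma (a + 1) (b + 1) n =
      (n + 1) * (n + a + b + 2) * jacobiGamma a b (n + 1) := by
  have hn : (0 : ℝ) ≤ n := n.cast_nonneg
  have e1 : (2 : ℝ) ^ (a + 1 + (b + 1) + 1) = 2 ^ (a + b + 1) * 4 := by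
    rw [show a + 1 + (b + 1) + 1 = a + b + 1 + (2 : ℕ) by push_cast; ring,
      Real.rpow_add_natCast (by norm_num)]
    norm_num
  have hp : 0 < (n : ℝ) + a + b + 2 := by linarith
  have g1 := Real.Gamma_add_one hp.ne'
  have g := (Real.Gamma_pos_of_pos hp).ne'
  rw [jacobiGamma, jacobiGamma, if_neg n.succ_ne_zero, e1]
  have hp2 : 0 < 2 * (n : ℝ) + a + b + 3 := by linarith
  split_ifs with h
  · subst h
    simp only [CharP.cast_eq_zero, zero_add] at *
    have g2 := Real.Gamma_add_one hp2.ne'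
    rw [show 2 * 0 + a + b + 3 = a + b + 3 by ring] at g2
    push_cast
    rw [show a + 1 + (b + 1) + 2 = a + b + 3 + 1 by ring, g2,
      show a + b + 3 = a + b + 2 + 1 by ring, g1, show 1 + a + 1 = a + 1 + 1 by ring,
      show 1 + b + 1 = b + 1 + 1 by ring, show 2 * 1 + a + b + 1 = a + b + 3 by ring,
      show 1 + a + b + 1 = a + b + 2 by ring]
    have : a + b + 2 + 1 ≠ 0 := by linarith
    have : a + b + 3 ≠ 0 := by linarith
    simp only [Nat.factorial_one, Nat.cast_one, one_mul, mul_one]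
    field_simp
    ring
  · rw [Nat.factorial_succ]
    push_cast
    rw [show (n : ℝ) + (a + 1) + (b + 1) + 1 = n + a + b + 2 + 1 by ring, g1,
      show (n : ℝ) + 1 + a + 1 = n + (a + 1) + 1 by ring,
      show (n : ℝ) + 1 + b + 1 = n + (b + 1) + 1 by ring,
      show 2 * ((n : ℝ) + 1) + a + b + 1 = 2 * n + a + b + 3 by ring,
      show 2 * (n : ℝ) + (a + 1) + (b + 1) + 1 = 2 * n + a + b + 3 by ring,
      show (n : ℝ) + 1 + a + b + 1 = n + a + b + 2 by ring]
    field_simp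
    ring

/-! ### Jacobi-Gauss-Lobatto quadrature -/

section Quadrature

variable {α β : ℝ} {N : ℕ} {x : Fin (N + 1) → ℝ}

/-- The interpolatory quadrature rule at the nodes `x`. -/
noncomputable def quad (α β : ℝ) (x : Fin (N + 1) → ℝ) (f : ℝ[X]) : ℝ :=
  ∑ j, f.eval (x j) * quadWeight α β x j

theorem wInt_eq_quad_of_degree_le (hα : -1 < α) (hβ : -1 < β) (hx : Function.Injective x)
    {f : ℝ[X]} (hf : f.degree < (N + 1 : ℕ)) : wInt α β f = quad α β x f := by
  have h := Lagrange.eq_interpolate (s := Finset.univ) (v := x) (f := f) hx.injOn (by simpa using hf)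
  rw [Lagrange.interpolate_apply] at h
  nth_rewrite 1 [h]
  rw [wInt_sum hα hβ]
  refine Finset.sum_congr rfl fun j _ => ?_
  rw [wInt_C_mul]
  rfl

theorem IsJGLNodes.eval_node (hx : IsJGLNodes N α β x) (j : Fin (N + 1)) :
    ((1 - X ^ 2) * derivative (jacobi α β N)).eval (x j) = 0 :=
  (hx.isRoot_iff _).2 ⟨j, rfl⟩

/-- The Gauss argument: divide `f` by the nodal polynomial `Q = (1-x²) P_N'`. The multiple of `Q`
vanishes at the nodes and integrates to zero, and the remainder is interpolated exactly. -/
theorem wInt_eq_quad (hN : 1 ≤ N) (hα : -1 < α) (hβ : -1 < β) (hx : IsJGLNodes N α β x)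
    {f : ℝ[X]} (hf : f.degree < (2 * N : ℕ)) : wInt α β f = quad α β x f := by
  have hnode := hx.eval_node
  set Q : ℝ[X] := (1 - X ^ 2) * derivative (jacobi α β N) with hQ
  obtain ⟨M, rfl⟩ : ∃ M, N = M + 1 := ⟨N - 1, by omega⟩
  have hM : (0 : ℝ) ≤ M := M.cast_nonneg
  have hc : (M + α + β + 2) / 2 ≠ 0 := by linarith
  have hd : derivative (jacobi α β (M + 1)) ≠ 0 ∧
      (derivative (jacobi α β (M + 1))).natDegree = M := by
    have h := degree_jacobi (a := α + 1) (b := β + 1) (by linarith) (by linarith) M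
    rw [derivative_jacobi_succ, natDegree_C_mul hc]
    exact ⟨mul_ne_zero (C_ne_zero.2 hc) (ne_zero_of_degree_gt (n := ⊥) (by rw [h]; simp)),
      natDegree_eq_of_degree_eq_some h⟩
  have hw : (1 - X ^ 2 : ℝ[X]) ≠ 0 ∧ (1 - X ^ 2 : ℝ[X]).natDegree = 2 := by
    have : (1 - X ^ 2 : ℝ[X]).natDegree = 2 := by compute_degree!
    exact ⟨by rintro h; simp [h] at this, this⟩
  have hQ0 : Q ≠ 0 := mul_ne_zero hw.1 hd.1
  have hQd : Q.natDegree = M + 2 := by rw [hQ, natDegree_mul hw.1 hd.1, hw.2, hd.2, add_comm]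
  have hdm := EuclideanDomain.div_add_mod f Q
  have hmod : (f % Q).degree < (M + 1 + 1 : ℕ) := by
    rw [← hQd, ← degree_eq_natDegree hQ0]
    exact degree_mod_lt f hQ0
  have hdiv : (f / Q).degree < M := by
    rcases eq_or_ne (f / Q) 0 with h0 | h0
    · rw [h0, degree_zero]; exact WithBot.bot_lt_coe _
    have h1 : (Q * (f / Q)).degree < (2 * (M + 1) : ℕ) := by
      rw [eq_sub_of_add_eq hdm]
      refine (degree_sub_le _ _).trans_lt (max_lt hf (hmod.trans_le ?_))
      exact_mod_cast (by omega : M + 1 + 1 ≤ 2 * (M + 1))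
    rw [← natDegree_lt_iff_degree_lt (mul_ne_zero hQ0 h0), natDegree_mul hQ0 h0, hQd] at h1
    rw [← natDegree_lt_iff_degree_lt h0]
    omega
  -- The factor `1 - X ^ 2` raises both weight parameters by one; for the new weight `P_N'` is
  -- orthogonal to degrees below `N - 1`.
  have hzero : wInt α β (Q * (f / Q)) = 0 := by
    generalize f / Q = d at hdiv
    rw [hQ, mul_assoc, ← wInt_add_one_add_one, derivative_jacobi_succ, mul_assoc, wInt_C_mul,
      wInt_jacobi_mul_of_degree_lt (by linarith) (by linarith) hdiv, mul_zero]
  calc wInt α β f = wInt α β (f % Q) := by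
        conv_lhs => rw [← hdm]
        rw [wInt_add hα hβ, hzero, zero_add]
    _ = quad α β x (f % Q) := wInt_eq_quad_of_degree_le hα hβ hx.strictMono.injective hmod
    _ = quad α β x f := by
        refine Finset.sum_congr rfl fun j _ => ?_
        conv_rhs => rw [← hdm]
        rw [eval_add, eval_mul, hnode j, zero_mul, zero_add]

/-- Adding `N⁻² (1-x²) P_N'²` to `P_N²` changes nothing at the nodes but lowers the degree below
`2N`, so exactness applies. The integral of the correction supplies the excess of `γ̃_N` over `γ_N`.
-/
theorem quad_jacobi_mul_self (hN : 1 ≤ N) (hα : -1 < α) (hβ : -1 < β) (hx : IsJGLNodes N α β x) :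
    quad α β x (jacobi α β N * jacobi α β N) = jacobiGammaTilde N α β N := by
  have hnode := hx.eval_node
  set P := jacobi α β N with hP
  set F : ℝ[X] := P * P + C (1 / (N : ℝ) ^ 2) * ((1 - X ^ 2) * (derivative P * derivative P))
  have hN0 : (N : ℝ) ≠ 0 := by positivity
  have hPd : P.natDegree ≤ N := natDegree_le_of_degree_le (degree_jacobi hα hβ N).le
  have hquad : quad α β x F = quad α β x (P * P) := by
    refine Finset.sum_congr rfl fun j _ => ?_
    have := hnode j
    rw [eval_add, eval_mul (p := C _), ← mul_assoc, eval_mul (q := derivative P), this]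
    simp
  obtain ⟨M, rfl⟩ : ∃ M, N = M + 1 := ⟨N - 1, by omega⟩
  have hP'd : (derivative P).natDegree ≤ M := (natDegree_derivative_le P).trans (by omega)
  have hw : (1 - X ^ 2 : ℝ[X]).natDegree ≤ 2 := by compute_degree
  have hF : F.degree < (2 * (M + 1) : ℕ) := by
    have d1 : (P * P).natDegree ≤ M + 1 + (M + 1) := natDegree_mul_le_of_le hPd hPd
    have d2 : (derivative P * derivative P).natDegree ≤ M + M := natDegree_mul_le_of_le hP'd hP'd
    have d3 : ((1 - X ^ 2) * (derivative P * derivative P)).natDegree ≤ 2 + (M + M) :=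
      natDegree_mul_le_of_le hw d2
    rw [degree_lt_iff_coeff_zero]
    intro m hm
    simp only [F, coeff_add, coeff_C_mul]
    rcases hm.eq_or_lt with rfl | hm
    -- If `P` has top coefficient `c`, then `(1-x²) P'²` has top coefficient `-N² c²`; the factor
    -- `1/N²` makes the two cancel.
    · have c1 := coeff_mul_add_eq_of_natDegree_le hPd hPd
      have c2 := coeff_mul_add_eq_of_natDegree_le hP'd hP'd
      have c3 := coeff_mul_add_eq_of_natDegree_le hw d2
      have c4 : (1 - X ^ 2 : ℝ[X]).coeff 2 = -1 := by simp [coeff_one]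
      rw [coeff_derivative] at c2
      rw [show 2 * (M + 1) = M + 1 + (M + 1) by ring, c1,
        show M + 1 + (M + 1) = 2 + (M + M) by ring, c3, c2, c4]
      push_cast
      field_simp
      ring
    · rw [coeff_eq_zero_of_natDegree_lt (by omega), coeff_eq_zero_of_natDegree_lt (by omega)]
      simp
  rw [← hquad, ← wInt_eq_quad hN hα hβ hx hF, wInt_add hα hβ, wInt_C_mul, ← wInt_add_one_add_one,
    wInt_jacobi_mul_self hα hβ, jacobiGammaTilde, if_pos rfl, hP, derivative_jacobi_succ,
    mul_mul_mul_comm, ← C_mul, wInt_C_mul, wInt_jacobi_mul_self (by linarith) (by linarith), ← sq,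
    jacobiGamma_succ hα hβ]
  push_cast at hN0 ⊢
  field_simp
  ring

theorem jacobiGammaTilde_ne_zero (hN : 1 ≤ N) (hα : -1 < α) (hβ : -1 < β) :
    jacobiGammaTilde N α β N ≠ 0 := by
  rw [jacobiGammaTilde, if_pos rfl]
  have hN1 : (1 : ℝ) ≤ N := by exact_mod_cast hN
  have h : 2 + (α + β + 1) / N = (2 * N + α + β + 1) / N := by field_simp; ring
  rw [h]
  have := jacobiGamma_pos hα hβ N
  have : 0 < 2 * (N : ℝ) + α + β + 1 := by linarith
  positivity

theorem quad_lagrangeBasis_mul (hx : Function.Injective x) (j : Fin (N + 1)) (p : ℝ[X]) :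
    quad α β x (lagrangeBasis x j * p) = p.eval (x j) * quadWeight α β x j := by
  rw [quad, Finset.sum_eq_single_of_mem j (Finset.mem_univ j)]
  · rw [eval_mul, lagrangeBasis, Lagrange.eval_basis_self hx.injOn (Finset.mem_univ j), one_mul]
  · intro k _ hk
    rw [eval_mul, lagrangeBasis, Lagrange.eval_basis_of_ne hk.symm (Finset.mem_univ k), zero_mul,
      zero_mul]

theorem degree_lagrangeBasis (hx : Function.Injective x) (j : Fin (N + 1)) :
    (lagrangeBasis x j).degree = N := by
  rw [lagrangeBasis, Lagrange.degree_basis hx.injOn (Finset.mem_univ j)]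
  simp

theorem lagrangeBasis_eq_sum_jacobi (hN : 1 ≤ N) (hα : -1 < α) (hβ : -1 < β)
    (hx : IsJGLNodes N α β x) (j : Fin (N + 1)) :
    lagrangeBasis x j =
      ∑ n ∈ Finset.range (N + 1), C (tCoeff α β x n j) * jacobi α β n := by
  have hinj := hx.strictMono.injective
  have hdeg := degree_lagrangeBasis hinj j
  have hexp := eq_sum_wInt_jacobi hα hβ (n := N + 1) (p := lagrangeBasis x j)
    (by rw [hdeg]; exact_mod_cast N.lt_succ_self)
  set c : ℕ → ℝ := fun m => wInt α β (lagrangeBasis x j * jacobi α β m) / jacobiGamma α β m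
  have hlt : ∀ n < N, c n = tCoeff α β x n j := by
    intro n hn
    have hd : (lagrangeBasis x j * jacobi α β n).degree < (2 * N : ℕ) := by
      rw [degree_mul, hdeg, degree_jacobi hα hβ]
      exact_mod_cast (by omega : N + n < 2 * N)
    simp only [c]
    rw [wInt_eq_quad hN hα hβ hx hd, quad_lagrangeBasis_mul hinj, tCoeff, jacobiGammaTilde,
      if_neg hn.ne]
    ring
  -- Apply the quadrature to `h_j P_N` in two ways: collapse it at `x_j`, or expand `h_j` and use
  -- discrete orthogonality, which leaves `c N * γ̃_N`.
  have hNN : c N = tCoeff α β x N j := by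
    have h1 := quad_lagrangeBasis_mul (α := α) (β := β) hinj j (jacobi α β N)
    have h2 : quad α β x (lagrangeBasis x j * jacobi α β N) =
        ∑ n ∈ Finset.range (N + 1), c n * quad α β x (jacobi α β n * jacobi α β N) := by
      rw [hexp]
      simp only [quad, Finset.mul_sum]
      rw [Finset.sum_comm]
      refine Finset.sum_congr rfl fun k _ => ?_
      rw [Finset.sum_mul, eval_finsetSum, Finset.sum_mul]
      refine Finset.sum_congr rfl fun n _ => ?_
      simp only [eval_mul, eval_C, c]
      ring
    rw [Finset.sum_range_succ, Finset.sum_eq_zero, zero_add, quad_jacobi_mul_self hN hα hβ hx,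
      h1] at h2
    · have := jacobiGammaTilde_ne_zero hN hα hβ
      rw [tCoeff, div_mul_eq_mul_div, mul_comm, h2]
      field_simp
    · intro n hn
      have hn := Finset.mem_range.1 hn
      have hd : (jacobi α β n * jacobi α β N).degree < (2 * N : ℕ) := by
        rw [degree_mul, degree_jacobi hα hβ, degree_jacobi hα hβ]
        exact_mod_cast (by omega : n + N < 2 * N)
      rw [← wInt_eq_quad hN hα hβ hx hd, wInt_jacobi_mul_jacobi hα hβ, if_neg hn.ne, mul_zero]
  rw [hexp]
  refine Finset.sum_congr rfl fun n hn => ?_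
  rcases (Nat.lt_succ_iff.1 (Finset.mem_range.1 hn)).eq_or_lt with rfl | h
  · exact congrArg (fun s => C s * _) hNN
  · exact congrArg (fun s => C s * _) (hlt n h)

theorem connCoeff_eq_wInt (α β a b : ℝ) (l n : ℕ) :
    connCoeff α β a b l n = wInt a b (jacobi α β n * jacobi a b l) / jacobiGamma a b l := by
  rw [connCoeff, wInt, one_div_mul_eq_div]
  simp only [eval_mul, mul_comm]

theorem lagrangeBasis_eq_sum_legendre (hN : 1 ≤ N) (hα : -1 < α) (hβ : -1 < β)
    (hx : IsJGLNodes N α β x) (j : Fin (N + 1)) :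
    lagrangeBasis x j =
      ∑ l ∈ Finset.range (N + 1), C (sHat α β x l j) * jacobi 0 0 l := by
  rw [lagrangeBasis_eq_sum_jacobi hN hα hβ hx j]
  have h : ∀ n ∈ Finset.range (N + 1), C (tCoeff α β x n j) * jacobi α β n =
      ∑ l ∈ Finset.range (n + 1),
        C (connCoeff α β 0 0 l n * tCoeff α β x n j) * jacobi 0 0 l := by
    intro n _
    conv_lhs => rw [eq_sum_wInt_jacobi (a := 0) (b := 0) (by norm_num) (by norm_num)
      (degree_jacobi_lt α β n), Finset.mul_sum]
    refine Finset.sum_congr rfl fun l _ => ?_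
    rw [connCoeff_eq_wInt, ← mul_assoc, ← C_mul, mul_comm (tCoeff α β x n j)]
  rw [Finset.sum_congr rfl h]
  simp only [sHat, map_sum, Finset.sum_mul]
  refine Finset.sum_comm' fun n l => ?_
  simp only [Finset.mem_range, Finset.mem_Icc]
  omega

theorem sHat_zero_zero (x : Fin (N + 1) → ℝ) {l : ℕ} (hl : l ≤ N) (j : Fin (N + 1)) :
    sHat 0 0 x l j = tCoeff 0 0 x l j := by
  have h0 : (-1 : ℝ) < 0 := by norm_num
  rw [sHat, Finset.sum_eq_single_of_mem l (Finset.mem_Icc.2 ⟨le_rfl, hl⟩)]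
  · rw [connCoeff_eq_wInt, wInt_jacobi_mul_self h0 h0, div_self (jacobiGamma_pos h0 h0 l).ne',
      one_mul]
  · intro n _ hn
    rw [connCoeff_eq_wInt, wInt_jacobi_mul_jacobi h0 h0, if_neg hn, zero_div, zero_mul]

end Quadrature

/-! ### Jacobi polynomials at the left end point -/

/-- Reflection turns the expansion about `1` into one about `-1`, with the parameters swapped; this
is the base point of the fractional integral. -/
theorem jacobi_eq_sum_halfAdd (ha : -1 < a) (hb : -1 < b) (n : ℕ) :
    jacobi a b n =
      ∑ k ∈ Finset.range (n + 1), C ((-1) ^ (n + k) * jacobiCoeff b a n k) * halfAdd ^ k := by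
  have h := jacobi_comp_neg_X ha hb n
  have h1 : jacobi a b n = C ((-1) ^ n) * (jacobi b a n).comp (-X) := by
    rw [h, ← mul_assoc, ← C_mul, ← mul_pow]
    simp
  rw [h1, jacobi_eq_sum, sum_comp, Finset.mul_sum]
  refine Finset.sum_congr rfl fun k _ => ?_
  rw [mul_comp, C_comp, pow_comp, halfSub_comp_neg_X, neg_pow, pow_add]
  simp only [C_mul, C_pow, C_neg, C_1]
  ring

theorem jacobiCoeff_pos (ha : 0 < a) (hb : 0 < b) {n k : ℕ} (hk : k ≤ n) :
    0 < jacobiCoeff a b n k := by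
  have h1 := Nat.choose_pos hk
  have h2 := ascPochhammer_pos k ((n : ℝ) + a + b + 1) (by positivity)
  have h3 := ascPochhammer_pos (n - k) (a + k + 1) (by positivity)
  rw [jacobiCoeff]
  positivity

/-- After reflection the argument exceeds `1` and every term of the expansion about `1` is positive.
Applied to `P_N'`, whose parameters `α + 1`, `β + 1` are positive, this keeps the nodes from lying
left of `-1`. -/
theorem eval_jacobi_ne_zero_of_lt (ha : 0 < a) (hb : 0 < b) (n : ℕ) {y : ℝ} (hy : y < -1) :
    (jacobi a b n).eval y ≠ 0 := by
  have h := congrArg (eval y) (jacobi_comp_neg_X (a := a) (b := b) (by linarith) (by linarith) n)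
  rw [eval_comp, eval_mul, eval_C, eval_neg, eval_X] at h
  intro h0
  rw [h0, mul_zero, jacobi_eq_sum, eval_finsetSum] at h
  refine (Finset.sum_pos (fun k hk => ?_) ⟨0, by simp⟩).ne' h
  have hc := jacobiCoeff_pos hb ha (Nat.lt_succ_iff.1 (Finset.mem_range.1 hk))
  have hs : 0 < halfSub.eval (-y) := by
    simp only [halfSub, eval_mul, eval_C, eval_sub, eval_X, eval_one]
    linarith
  rw [eval_mul, eval_C, eval_pow]
  positivity

theorem IsJGLNodes.neg_one_le {N : ℕ} {α β : ℝ} {x : Fin (N + 1) → ℝ} (hx : IsJGLNodes N α β x)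
    (hN : 1 ≤ N) (hα : -1 < α) (hβ : -1 < β) (i : Fin (N + 1)) : -1 ≤ x i := by
  by_contra! hlt
  have h := hx.eval_node i
  obtain ⟨M, rfl⟩ : ∃ M, N = M + 1 := ⟨N - 1, by omega⟩
  have hM : (0 : ℝ) ≤ M := M.cast_nonneg
  rw [derivative_jacobi_succ, eval_mul, eval_mul, eval_C] at h
  refine mul_ne_zero ?_ (mul_ne_zero ?_ ?_) h
  · simp only [eval_sub, eval_one, eval_pow, eval_X]
    nlinarith
  · linarith
  · exact eval_jacobi_ne_zero_of_lt (by linarith) (by linarith) M hlt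

theorem IsJGLNodes.node_zero {N : ℕ} {α β : ℝ} {x : Fin (N + 1) → ℝ} (hx : IsJGLNodes N α β x)
    (hN : 1 ≤ N) (hα : -1 < α) (hβ : -1 < β) : x 0 = -1 := by
  obtain ⟨j, hj⟩ := (hx.isRoot_iff (-1)).1 (by simp [IsRoot])
  exact le_antisymm (hj ▸ hx.strictMono.monotone (Fin.zero_le j)) (hx.neg_one_le hN hα hβ 0)

/-! ### Fractional integrals of polynomials -/

theorem intervalIntegrable_div_rpow {μ z : ℝ} (hμ : 0 < μ) (hz : -1 < z) (p : ℝ[X]) :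
    IntervalIntegrable (fun y => p.eval y / (z - y) ^ (1 - μ)) volume (-1) z := by
  have h := intervalIntegrable_rpow_mul_rpow (p := -1) (q := z) (u := μ - 1) (v := 0) hz
    (by linarith) (by norm_num)
  refine (h.continuousOn_mul p.continuous.continuousOn).congr fun y hy => ?_
  rw [Set.uIoc_of_le hz.le] at hy
  simp only [Real.rpow_zero, mul_one]
  rw [← neg_sub 1 μ, Real.rpow_neg (by linarith [hy.2]), div_eq_mul_inv]

/-- A beta integral on `(-1, z)` with exponents `μ - 1` and `k`; its `Γ(μ)` cancels the
normalization of the fractional integral. -/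
theorem fracInt_halfAdd_pow {μ z : ℝ} (hμ : 0 < μ) (hz : -1 < z) (k : ℕ) :
    fracInt μ (fun y => (halfAdd ^ k).eval y) z =
      (1 + z) ^ μ * (k.factorial / Real.Gamma (k + μ + 1) * (halfAdd ^ k).eval z) := by
  have hk : (0 : ℝ) ≤ k := k.cast_nonneg
  have h := integral_rpow_mul_rpow (p := -1) (q := z) (u := μ - 1) (v := k) hz
    (by linarith) (by linarith)
  have hc : ∫ y in (-1 : ℝ)..z, (halfAdd ^ k).eval y / (z - y) ^ (1 - μ) =
      ∫ y in (-1 : ℝ)..z, (2⁻¹) ^ k * ((z - y) ^ (μ - 1) * (y - -1) ^ (k : ℝ)) := by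
    refine intervalIntegral.integral_congr fun y hy => ?_
    rw [Set.uIcc_of_le hz.le] at hy
    simp only [Real.rpow_natCast, halfAdd, eval_pow, eval_mul, eval_C, eval_add, eval_X, eval_one]
    rw [← neg_sub 1 μ, Real.rpow_neg (by linarith [hy.2]), mul_pow]
    ring
  have hg := (Real.Gamma_pos_of_pos hμ).ne'
  have e : (z - -1) ^ (μ - 1 + k + 1) = (1 + z) ^ μ * (1 + z) ^ k := by
    rw [← Real.rpow_add_natCast (by linarith)]
    congr 1 <;> ring
  rw [fracInt, hc, intervalIntegral.integral_const_mul, h, e, Real.Gamma_nat_eq_factorial,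
    show μ - 1 + 1 = μ by ring, show μ - 1 + (k : ℝ) + 2 = k + μ + 1 by ring]
  simp only [halfAdd, eval_pow, eval_mul, eval_C, eval_add, eval_X, eval_one, mul_pow]
  field_simp
  ring

theorem fracInt_sum {μ z : ℝ} (hμ : 0 < μ) (hz : -1 < z) (s : Finset ℕ) (c : ℕ → ℝ)
    (f : ℕ → ℝ[X]) :
    fracInt μ (fun y => (∑ k ∈ s, C (c k) * f k).eval y) z =
      ∑ k ∈ s, c k * fracInt μ (fun y => (f k).eval y) z := by
  simp only [fracInt]
  have h : ∀ y, (∑ k ∈ s, C (c k) * f k).eval y / (z - y) ^ (1 - μ) =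
      ∑ k ∈ s, c k * ((f k).eval y / (z - y) ^ (1 - μ)) := by
    intro y
    rw [eval_finsetSum, Finset.sum_div]
    refine Finset.sum_congr rfl fun k _ => ?_
    rw [eval_mul, eval_C, mul_div_assoc]
  simp only [h]
  rw [intervalIntegral.integral_finsetSum fun k _ =>
    (intervalIntegrable_div_rpow hμ hz (f k)).const_mul (c k), Finset.mul_sum]
  refine Finset.sum_congr rfl fun k _ => ?_
  rw [intervalIntegral.integral_const_mul]
  ring

/-- Since `μ + (-μ) = 0`, both families share the factor `(l+1)_k`; only the Gamma factors differ.
The order `μ, -μ` is that of the expansion of `P_l^{(-μ,μ)}` about `-1`. -/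
theorem jacobiCoeff_zero_zero_mul {μ : ℝ} (hμ : -1 < μ) {l k : ℕ} (hk : k ≤ l) :
    jacobiCoeff 0 0 l k * (k.factorial / Real.Gamma (k + μ + 1)) =
      l.factorial / Real.Gamma (l + μ + 1) * jacobiCoeff μ (-μ) l k := by
  have hk0 : (0 : ℝ) ≤ k := k.cast_nonneg
  have hl0 : (0 : ℝ) ≤ l := l.cast_nonneg
  have h1 := jacobiCoeff_mul_Gamma (a := 0) (b := 0) (by norm_num) hk
  have h2 := jacobiCoeff_mul_Gamma (a := μ) (b := -μ) hμ hk
  rw [zero_add, Real.Gamma_nat_eq_factorial, add_zero, Real.Gamma_nat_eq_factorial, add_zero] at h1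
  rw [show (l : ℝ) + μ + -μ + 1 = l + 1 by ring, show μ + (k : ℝ) + 1 = k + μ + 1 by ring] at h2
  have g1 := (Real.Gamma_pos_of_pos (s := k + μ + 1) (by linarith)).ne'
  have g2 := (Real.Gamma_pos_of_pos (s := l + μ + 1) (by linarith)).ne'
  rw [← mul_div_assoc, h1, div_eq_iff g1, mul_assoc (_ / _), h2]
  field_simp

/-- Fractional integration maps Legendre polynomials to Jacobi polynomials. -/
theorem fracInt_legendre {μ z : ℝ} (hμ : μ ∈ Set.Ioo (0 : ℝ) 1) (hz : -1 < z) (l : ℕ) :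
    fracInt μ (fun y => (jacobi 0 0 l).eval y) z =
      (1 + z) ^ μ * (l.factorial / Real.Gamma (l + μ + 1) * (jacobi (-μ) μ l).eval z) := by
  rw [jacobi_eq_sum_halfAdd (a := 0) (b := 0) (by norm_num) (by norm_num),
    jacobi_eq_sum_halfAdd (a := -μ) (b := μ) (by linarith [hμ.2]) (by linarith [hμ.1]),
    fracInt_sum hμ.1 hz, eval_finsetSum, Finset.mul_sum, Finset.mul_sum]
  refine Finset.sum_congr rfl fun k hk => ?_
  have h := jacobiCoeff_zero_zero_mul (μ := μ) (by linarith [hμ.1])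
    (Nat.lt_succ_iff.1 (Finset.mem_range.1 hk))
  rw [fracInt_halfAdd_pow hμ.1 hz, eval_mul, eval_C]
  calc _ = (1 + z) ^ μ * ((-1) ^ (l + k) *
        (jacobiCoeff 0 0 l k * (k.factorial / Real.Gamma (k + μ + 1))) * (halfAdd ^ k).eval z) := by
        ring
    _ = _ := by rw [h]; ring

theorem rpow_neg_mul_fracInt_lagrangeBasis {N : ℕ} {α β μ z : ℝ} {x : Fin (N + 1) → ℝ}
    (hN : 1 ≤ N) (hα : -1 < α) (hβ : -1 < β) (hx : IsJGLNodes N α β x)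
    (hμ : μ ∈ Set.Ioo (0 : ℝ) 1) (hz : -1 < z) (j : Fin (N + 1)) :
    (1 + z) ^ (-μ) * fracInt μ (fun y => (lagrangeBasis x j).eval y) z =
      ∑ l ∈ Finset.range (N + 1),
        (l.factorial : ℝ) / Real.Gamma (l + μ + 1) * sHat α β x l j *
          (jacobi (-μ) μ l).eval z := by
  have hz' : 0 < 1 + z := by linarith
  rw [lagrangeBasis_eq_sum_legendre hN hα hβ hx j, fracInt_sum hμ.1 hz, Finset.mul_sum]
  refine Finset.sum_congr rfl fun l _ => ?_
  have h := (Real.rpow_pos_of_pos hz' μ).ne'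
  rw [fracInt_legendre hμ hz, Real.rpow_neg hz'.le]
  field_simp

theorem tendsto_rpow_neg_mul_fracInt_lagrangeBasis {N : ℕ} {α β μ : ℝ} {x : Fin (N + 1) → ℝ}
    (hN : 1 ≤ N) (hα : -1 < α) (hβ : -1 < β) (hx : IsJGLNodes N α β x)
    (hμ : μ ∈ Set.Ioo (0 : ℝ) 1) (j : Fin (N + 1)) :
    Tendsto (fun z => (1 + z) ^ (-μ) * fracInt μ (fun y => (lagrangeBasis x j).eval y) z)
      (𝓝[>] (-1)) (𝓝 (∑ l ∈ Finset.range (N + 1),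
        (l.factorial : ℝ) / Real.Gamma (l + μ + 1) * sHat α β x l j *
          (jacobi (-μ) μ l).eval (-1))) := by
  have hcont : Continuous fun z : ℝ => ∑ l ∈ Finset.range (N + 1),
        (l.factorial : ℝ) / Real.Gamma (l + μ + 1) * sHat α β x l j *
          (jacobi (-μ) μ l).eval z :=
    continuous_finsetSum _ fun l _ => continuous_const.mul (jacobi (-μ) μ l).continuous
  refine ((hcont.tendsto (-1)).mono_left nhdsWithin_le_nhds).congr' ?_
  filter_upwards [self_mem_nhdsWithin] with z hz
  exact (rpow_neg_mul_fracInt_lagrangeBasis hN hα hβ hx hμ hz j).symm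

theorem modFracIntMatrix_apply {N : ℕ} {α β μ : ℝ} {x : Fin (N + 1) → ℝ}
    (hN : 1 ≤ N) (hα : -1 < α) (hβ : -1 < β) (hx : IsJGLNodes N α β x)
    (hμ : μ ∈ Set.Ioo (0 : ℝ) 1) (i j : Fin (N + 1)) :
    modFracIntMatrix μ x i j =
      ∑ l ∈ Finset.range (N + 1),
        (l.factorial : ℝ) / Real.Gamma (l + μ + 1) * sHat α β x l j *
          (jacobi (-μ) μ l).eval (x i) := by
  rw [modFracIntMatrix, Matrix.of_apply, modFracInt]
  -- At the node `-1` the entry is the limit of the formula; any other node lies strictly right of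
  -- `-1`, where the formula holds directly.
  split_ifs with h
  · rw [h]
    exact (tendsto_rpow_neg_mul_fracInt_lagrangeBasis hN hα hβ hx hμ j).limUnder_eq
  · exact rpow_neg_mul_fracInt_lagrangeBasis hN hα hβ hx hμ
      (lt_of_le_of_ne (hx.neg_one_le hN hα hβ i) (Ne.symm h)) j

end JacobiFrac

/-- The first two conjuncts say that the quantities entering the matrix are genuine: the fractional
integrals of the `h_j` converge, and the limits that define the row of the node `-1` exist. -/
theorem theorem3p4 (N : ℕ) (hN : 1 ≤ N) (α β : ℝ) (hα : -1 < α) (hβ : -1 < β)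
    (x : Fin (N + 1) → ℝ) (hx : IsJGLNodes N α β x) (μ : ℝ) (hμ : μ ∈ Set.Ioo (0 : ℝ) 1) :
    (∀ j : Fin (N + 1), ∀ z ∈ Set.Ioc (-1 : ℝ) 1,
      IntervalIntegrable (fun y => (lagrangeBasis x j).eval y / (z - y) ^ (1 - μ))
        MeasureTheory.volume (-1) z) ∧
    (∀ j : Fin (N + 1),
      Tendsto (fun y => (1 + y) ^ (-μ) * fracInt μ (fun w => (lagrangeBasis x j).eval w) y)
        (𝓝[>] (-1)) (𝓝 (modFracIntMatrix μ x 0 j))) ∧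
    (∀ i j : Fin (N + 1),
      modFracIntMatrix μ x i j =
        ∑ l ∈ Finset.range (N + 1),
          (l.factorial : ℝ) / Real.Gamma (l + μ + 1) * sHat α β x l j *
            (jacobi (-μ) μ l).eval (x i)) ∧
    (α = 0 → β = 0 → ∀ l ≤ N, ∀ j : Fin (N + 1), sHat α β x l j = tCoeff α β x l j) := by
  refine ⟨fun j z hz => intervalIntegrable_div_rpow hμ.1 hz.1 _, fun j => ?_,
    modFracIntMatrix_apply hN hα hβ hx hμ, ?_⟩
  · rw [modFracIntMatrix_apply hN hα hβ hx hμ, hx.node_zero hN hα hβ]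
    exact tendsto_rpow_neg_mul_fracInt_lagrangeBasis hN hα hβ hx hμ j
  · rintro rfl rfl l hl j
    exact sHat_zero_zero x hl j
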